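/- Let $K$ be a field, let $G$ be a simple graph on the vertex set $[n]=\{1,\dots,n\}$ with edge set $E(G)$, and let $S=K[x_{ab}: 1\le a,b\le n]$ be the polynomial ring in the entries of an $n\times n$ matrix of variables. For $1\le a<b\le n$ put $f_{ab}=x_{aa}x_{bb}-x_{ab}x_{ba}$, and let $P_G$ be the ideal of $S$ generated by all $f_{ab}$ with $a<b$ and $\{a,b\}\in E(G)$. For a vertex $v$ let $N(v)$ be its set of neighbours in $G$, let $G\setminus\{v\}$ be the graph obtained by removing $v$ and all edges incident to $v$, let $P_{G\setminus\{v\}}$ be the ideal of $S$ generated by all $f_{ab}$ with $a<b$ and $\{a,b\}$ an edge of $G\setminus\{v\}$, and for $a\in N(v)$ let $E_a^v=\{x_{av},x_{va}\}$. An ideal $I$ is called unmixed if every associated prime of $S/I$ has the same height as $I$. Let $\{i,j\}$ with $i<j$ be an edge of $G$. Then: (a) $(P_G,x_{ji})$ is an unmixed radical ideal with $\operatorname{height}(P_G,x_{ji})=\operatorname{height}P_G+1$. (b) The set of minimal primes of $(P_G,x_{ji})$ is $\mathcal C_1(i,j)\cup\mathcal C_2(i,j)$, where $\mathcal C_1(i,j)$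 is the set of all ideals $(P_{G\setminus\{i\}},x_{ii},x_{ji},T)$ of $S$ with $T$ any set of variables such that $T\subset\bigcup_{a\in N(i)\setminus\{j\}}E_a^i$ and $|T\cap E_a^i|=1$ for all $a\in N(i)\setminus\{j\}$, and $\mathcal C_2(i,j)$ is the set of all ideals $(P_{G\setminus\{j\}},x_{jj},x_{ji},U)$ of $S$ with $U$ any set of variables such that $U\subset\bigcup_{b\in N(j)\setminus\{i\}}E_b^j$ and $|U\cap E_b^j|=1$ for all $b\in N(j)\setminus\{i\}$. -/

import Mathlib

namespace DiagonalMinors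

open MvPolynomial

noncomputable section

/-- The polynomial ring `S = K[X]` in the entries `x_{ab}` of a generic `n × n` matrix;
the variable `x_{ab}` is `X (a, b)`. -/
abbrev MatrixPoly (n : ℕ) (K : Type*) [Field K] : Type _ := MvPolynomial (Fin n × Fin n) K

/-- The diagonal `2`-minor `f_{ab} = x_{aa} x_{bb} - x_{ab} x_{ba}`. -/
def diagMinor {n : ℕ} (K : Type*) [Field K] (a b : Fin n) : MatrixPoly n K :=
  X (a, a) * X (b, b) - X (a, b) * X (b, a)

/-- The ideal `P_G` of `S` generated by the `f_{ab}` with `a < b` and `{a, b}` an edge of `G`. -/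
def diagIdeal {n : ℕ} (K : Type*) [Field K] (G : SimpleGraph (Fin n)) : Ideal (MatrixPoly n K) :=
  Ideal.span {f | ∃ a b : Fin n, a < b ∧ G.Adj a b ∧ f = diagMinor K a b}

/-- The set of variables `E_a^i = {x_{ai}, x_{ia}}`. -/
def varPair {n : ℕ} (K : Type*) [Field K] (i a : Fin n) : Set (MatrixPoly n K) :=
  {X (a, i), X (i, a)}

/-- `T` is a set of variables contained in the union of the `E_a^i`, `a ∈ N(i) \ {j}`, that
meets each of these `E_a^i` in exactly one element. -/
def IsTransversal {n : ℕ} (K : Type*) [Field K] (G : SimpleGraph (Fin n)) (i j : Fin n)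
    (T : Set (MatrixPoly n K)) : Prop :=
  T ⊆ ⋃ a ∈ G.neighborSet i \ {j}, varPair K i a ∧
    ∀ a ∈ G.neighborSet i \ {j}, (T ∩ varPair K i a).ncard = 1

/-- The set of all ideals `(P_{G \ {v}}, x_{vv}, y, T)` of `S`, where `T` runs through the sets of
variables choosing one variable from each `E_a^v`, `a ∈ N(v) \ {w}`. Here `P_{G \ {v}}` is the ideal
of `S` generated by the diagonal minors of the edges of `G` that do not contain `v`
(`deleteIncidenceSet` keeps `v` as an isolated vertex, which contributes no generator). -/
def primeClass {n : ℕ} (K : Type*) [Field K] (G : SimpleGraph (Fin n)) (v w : Fin n)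
    (y : MatrixPoly n K) : Set (Ideal (MatrixPoly n K)) :=
  {Q | ∃ T : Set (MatrixPoly n K), IsTransversal K G v w T ∧
    Q = diagIdeal K (G.deleteIncidenceSet v) ⊔ Ideal.span ({X (v, v), y} ∪ T)}

/-- An ideal `I` is unmixed if all associated primes of `R / I` have the same height as `I`
(so in particular there are no embedded primes). -/
def IsUnmixed {R : Type*} [CommRing R] (I : Ideal R) : Prop :=
  ∀ P ∈ associatedPrimes R (R ⧸ I), P.height = I.height

end

end DiagonalMinors

/-!
The ideal `P_G` is prime: rewriting `x_{ab} x_{ba}` to `x_{aa} x_{bb}` along the edges brings every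
monomial into a normal form, and distinct normal forms have distinct images under a homomorphism
`toricHom` to a Laurent polynomial ring, so `P_G` is its kernel (`isPrime_diagIdeal`). Adjoining
variables that do not occur in the generators keeps the ideal prime. Adding edges and variables one
at a time gives a strict chain of primes, and Krull's height theorem bounds the height by the number
of generators; so the height is the number of edges plus the number of variables
(`height_diagVarIdeal`). In particular all members of `primeClass` are primes of height
`height P_G + 1`.

Repeated use of `(I, f) ∩ (I, g) = I`, valid when `f g ∈ I` and `g` is a nonzerodivisor modulo
`(I, f)`, shows that `(P_G, x_{ji})` is the intersection of these primes: modulo the ideal,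
`x_{ii} x_{jj} = 0`, and once `x_{vv}` is adjoined, each minor `f_{av}` becomes the product
`- x_{av} x_{va}` (`sup_span_X_eq_sInf`). A finite intersection of primes of equal height is radical
and unmixed, has that height, and has exactly these primes as minimal primes.
-/

namespace DiagonalMinors

open MvPolynomial

/-! ### Finite intersections of primes of equal height -/

section FiniteIntersection

variable {R : Type*} [CommRing R]

lemma exists_mem_le_of_sInf_le {F : Set (Ideal R)} (hF : F.Finite) {P : Ideal R}
    (hP : P.IsPrime) (h : sInf F ≤ P) : ∃ Q ∈ F, Q ≤ P := by
  have h' : hF.toFinset.inf id ≤ P := by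
    rwa [Finset.inf_id_eq_sInf, hF.coe_toFinset]
  obtain ⟨Q, hQ, hQP⟩ := (Ideal.IsPrime.inf_le' hP).1 h'
  exact ⟨Q, hF.mem_toFinset.1 hQ, hQP⟩

lemma isRadical_sInf_of_isPrime {F : Set (Ideal R)} (hprime : ∀ Q ∈ F, Q.IsPrime) :
    (sInf F).IsRadical := by
  rintro x ⟨k, hk⟩
  rw [Submodule.mem_sInf] at hk ⊢
  exact fun Q hQ => (hprime Q hQ).mem_of_pow_mem k (hk Q hQ)

lemma minimalPrimes_sInf_of_height_eq [IsNoetherianRing R] {F : Set (Ideal R)} (hF : F.Finite)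
    (hprime : ∀ Q ∈ F, Q.IsPrime) {h : ℕ∞} (hheight : ∀ Q ∈ F, Q.height = h) :
    (sInf F).minimalPrimes = F := by
  have key : ∀ Q ∈ F, ∀ P : Ideal R, P.IsPrime → sInf F ≤ P → P ≤ Q → P = Q := by
    intro Q hQ P hP hFP hPQ
    obtain ⟨Q', hQ', hle⟩ := exists_mem_le_of_sInf_le hF hP hFP
    have := hprime Q' hQ'
    have e : Q' = Q := Ideal.eq_of_le_of_height_le Q' (hle.trans hPQ)
      ((hheight Q hQ).trans (hheight Q' hQ').symm).le
    exact le_antisymm hPQ (e ▸ hle)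
  ext P
  constructor
  · intro hP
    obtain ⟨Q, hQ, hle⟩ := exists_mem_le_of_sInf_le hF hP.isPrime hP.le
    have e : P = Q := le_antisymm (hP.2 ⟨hprime Q hQ, sInf_le hQ⟩ hle) hle
    exact e ▸ hQ
  · intro hP
    refine ⟨⟨hprime P hP, sInf_le hP⟩, fun P' hP' hle => ?_⟩
    exact (key P hP P' hP'.1 hP'.2 hle).ge

lemma height_sInf_of_height_eq [IsNoetherianRing R] {F : Set (Ideal R)} (hF : F.Finite)
    (hne : F.Nonempty) (hprime : ∀ Q ∈ F, Q.IsPrime) {h : ℕ∞}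
    (hheight : ∀ Q ∈ F, Q.height = h) : (sInf F).height = h := by
  rw [Ideal.height_eq_inf_minimalPrimes, minimalPrimes_sInf_of_height_eq hF hprime hheight]
  obtain ⟨Q, hQ⟩ := hne
  exact le_antisymm ((iInf₂_le Q hQ).trans (hheight Q hQ).le)
    (le_iInf₂ fun P hP => (hheight P hP).ge)

/-- An associated prime of `R / ⋂ Q` is a colon ideal `(⋂ Q : r)`, that is, the intersection of
those `Q` that do not contain `r`; being prime, it is one of them. -/
lemma associatedPrimes_quotient_sInf_subset [IsNoetherianRing R] {F : Set (Ideal R)}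
    (hF : F.Finite) (hprime : ∀ Q ∈ F, Q.IsPrime) :
    associatedPrimes R (R ⧸ sInf F) ⊆ F := by
  intro P hP
  obtain ⟨hP, x, hx⟩ := isAssociatedPrime_iff.1 hP
  obtain ⟨r, rfl⟩ := Ideal.Quotient.mk_surjective x
  have hmem : ∀ s, s ∈ P ↔ s * r ∈ sInf F := by
    intro s
    rw [hx, Submodule.mem_colon_singleton, Submodule.mem_bot, ← Ideal.Quotient.eq_zero_iff_mem,
      map_mul]
    rfl
  obtain ⟨Q, ⟨hQ, hrQ⟩, hQP⟩ :=
    exists_mem_le_of_sInf_le (hF.subset (Set.sep_subset F fun Q => r ∉ Q)) hP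
    (by
      intro s hs
      rw [hmem, Submodule.mem_sInf]
      intro Q hQ
      by_cases hr : r ∈ Q
      · exact Ideal.mul_mem_left Q s hr
      · exact Ideal.mul_mem_right r Q (Submodule.mem_sInf.1 hs Q ⟨hQ, hr⟩))
  have hPQ : P ≤ Q := fun s hs =>
    ((hprime Q hQ).mem_or_mem (Submodule.mem_sInf.1 ((hmem s).1 hs) Q hQ)).resolve_right hrQ
  exact le_antisymm hPQ hQP ▸ hQ

/-- If `f * g ∈ I` and `g` is a nonzerodivisor modulo `(I, f)`, then `I = (I, f) ∩ (I, g)`. -/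
lemma mem_of_mem_sup_span_singleton {I : Ideal R} {f g u : R} (hfg : f * g ∈ I)
    (hreg : ∀ b, g * b ∈ I ⊔ Ideal.span {f} → b ∈ I ⊔ Ideal.span {f})
    (hf : u ∈ I ⊔ Ideal.span {f}) (hg : u ∈ I ⊔ Ideal.span {g}) : u ∈ I := by
  obtain ⟨s, hs, t, ht, rfl⟩ := Submodule.mem_sup.1 hg
  obtain ⟨b, rfl⟩ := Ideal.mem_span_singleton'.1 ht
  have hb : b ∈ I ⊔ Ideal.span {f} := by
    refine hreg b ?_
    have := Ideal.sub_mem _ hf (Ideal.mem_sup_left hs)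
    rwa [add_sub_cancel_left, mul_comm] at this
  obtain ⟨s', hs', t', ht', rfl⟩ := Submodule.mem_sup.1 hb
  obtain ⟨c, rfl⟩ := Ideal.mem_span_singleton'.1 ht'
  have e : s + (s' + c * f) * g = s + s' * g + c * (f * g) := by ring
  rw [e]
  exact I.add_mem (I.add_mem hs (I.mul_mem_right g hs')) (I.mul_mem_left c hfg)

end FiniteIntersection

/-! ### Primality of `P_G` -/

section Toric

variable {n : ℕ} (K : Type*) [Field K] (G : SimpleGraph (Fin n))

open Classical in
/-- The exponent map of a toric parametrization of `S / P_G`: its entry at `(a, b)` with `a ≠ b` is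
`u_{ab} - u_{ba}` along an edge and `u_{ab}` otherwise; its entry at `(a, a)` is the degree of the
monomial `x ^ u` for the grading in which `x_{aa}` has degree `2` and, for every edge `{a, d}`,
both `x_{ad}` and `x_{da}` have degree `1`. It identifies `x_{aa} x_{bb}` with `x_{ab} x_{ba}`
exactly along edges, without reference to the order of the vertices. -/
noncomputable def toricExponent : (Fin n × Fin n →₀ ℕ) →+ (Fin n × Fin n → ℤ) where
  toFun u p :=
    if p.1 = p.2 then
      2 * (u (p.1, p.1) : ℤ) +
        ∑ d, if G.Adj p.1 d then (u (p.1, d) + u (d, p.1) : ℤ) else 0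
    else if G.Adj p.1 p.2 then (u (p.1, p.2) - u (p.2, p.1) : ℤ) else u (p.1, p.2)
  map_zero' := by
    ext p
    simp
  map_add' u v := by
    ext p
    simp only [Pi.add_apply, Finsupp.add_apply, Nat.cast_add]
    split_ifs
    · have : ∀ d, (if G.Adj p.1 d then
          (u (p.1, d) + v (p.1, d) + (u (d, p.1) + v (d, p.1)) : ℤ) else 0) =
          (if G.Adj p.1 d then (u (p.1, d) + u (d, p.1) : ℤ) else 0) +
          (if G.Adj p.1 d then (v (p.1, d) + v (d, p.1) : ℤ) else 0) := by
        intro d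
        split_ifs <;> ring
      rw [Finset.sum_congr rfl fun d _ => this d, Finset.sum_add_distrib]
      ring
    · ring
    · ring

open Classical in
lemma toricExponent_diag_of_adj {a b : Fin n} (hab : G.Adj a b) :
    toricExponent G (Finsupp.single (a, a) 1 + Finsupp.single (b, b) 1) =
      toricExponent G (Finsupp.single (a, b) 1 + Finsupp.single (b, a) 1) := by
  have hne := hab.ne
  have hba := hab.symm
  ext ⟨c, d⟩
  by_cases hcd : c = d
  · subst hcd
    have h0 : ∀ x, (if G.Adj c x then
        (((Finsupp.single (a, a) 1 + Finsupp.single (b, b) 1 : Fin n × Fin n →₀ ℕ) (c, x) : ℤ) +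
          ((Finsupp.single (a, a) 1 + Finsupp.single (b, b) 1 : Fin n × Fin n →₀ ℕ) (x, c) : ℤ))
          else 0) = 0 := by
      intro x
      split_ifs with hx
      · have := hx.ne
        simp only [Finsupp.add_apply, Finsupp.single_apply, Prod.mk.injEq]
        grind
      · rfl
    have h1 : ∀ x, (if G.Adj c x then
        (((Finsupp.single (a, b) 1 + Finsupp.single (b, a) 1 : Fin n × Fin n →₀ ℕ) (c, x) : ℤ) +
          ((Finsupp.single (a, b) 1 + Finsupp.single (b, a) 1 : Fin n × Fin n →₀ ℕ) (x, c) : ℤ))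
          else 0) = (if x = b then if c = a then 2 else 0 else 0) +
            (if x = a then if c = b then 2 else 0 else 0) := by
      intro x
      simp only [Finsupp.add_apply, Finsupp.single_apply, Prod.mk.injEq]
      grind
    simp only [toricExponent, AddMonoidHom.coe_mk, ZeroHom.coe_mk, if_true]
    rw [Finset.sum_congr rfl fun x _ => h0 x, Finset.sum_congr rfl fun x _ => h1 x,
      Finset.sum_add_distrib]
    simp only [Finset.sum_ite_eq', Finset.mem_univ, if_true, Finset.sum_const_zero]
    simp only [Finsupp.add_apply, Finsupp.single_apply, Prod.mk.injEq]
    grind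
  · simp only [toricExponent, AddMonoidHom.coe_mk, ZeroHom.coe_mk, hcd, if_false]
    simp only [Finsupp.add_apply, Finsupp.single_apply, Prod.mk.injEq]
    grind

/-- The monomial `x ^ u` is in normal form modulo `P_G`: no product `x_{ab} x_{ba}` with
`{a, b}` an edge divides it. -/
def IsReduced (u : Fin n × Fin n →₀ ℕ) : Prop :=
  ∀ a b, G.Adj a b → u (a, b) = 0 ∨ u (b, a) = 0

open Classical in
variable {G} in
/-- Distinct normal forms have distinct toric exponents. -/
lemma IsReduced.eq_of_toricExponent_eq {u v : Fin n × Fin n →₀ ℕ} (hu : IsReduced G u)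
    (hv : IsReduced G v) (h : toricExponent G u = toricExponent G v) : u = v := by
  have hoff : ∀ a b, a ≠ b → u (a, b) = v (a, b) := by
    intro a b hab
    have h' := congrFun h (a, b)
    simp only [toricExponent, AddMonoidHom.coe_mk, ZeroHom.coe_mk, hab, if_false] at h'
    split_ifs at h' with hadj
    · have := hu a b hadj
      have := hv a b hadj
      omega
    · exact_mod_cast h'
  ext ⟨a, b⟩
  by_cases hab : a = b
  · subst hab
    have h' := congrFun h (a, a)
    simp only [toricExponent, AddMonoidHom.coe_mk, ZeroHom.coe_mk, if_true] at h'
    have hs : ∀ d, (if G.Adj a d then (u (a, d) + u (d, a) : ℤ) else 0) =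
        if G.Adj a d then (v (a, d) + v (d, a) : ℤ) else 0 := by
      intro d
      split_ifs with hd
      · rw [hoff a d hd.ne, hoff d a hd.ne']
      · rfl
    rw [Finset.sum_congr rfl fun d _ => hs d] at h'
    omega
  · exact hoff a b hab

lemma diagMinor_comm (a b : Fin n) : diagMinor K a b = diagMinor K b a := by
  simp only [diagMinor]
  ring

variable {G} in
lemma diagMinor_mem_diagIdeal {a b : Fin n} (h : G.Adj a b) : diagMinor K a b ∈ diagIdeal K G := by
  rcases lt_or_gt_of_ne h.ne with hab | hab
  · exact Ideal.subset_span ⟨a, b, hab, h, rfl⟩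
  · rw [diagMinor_comm]
    exact Ideal.subset_span ⟨b, a, hab, h.symm, rfl⟩

variable {K} in
lemma diagIdeal_le_iff {I : Ideal (MatrixPoly n K)} :
    diagIdeal K G ≤ I ↔ ∀ a b, G.Adj a b → diagMinor K a b ∈ I := by
  constructor
  · exact fun h a b hab => h (diagMinor_mem_diagIdeal K hab)
  · intro h
    rw [diagIdeal, Ideal.span_le]
    rintro _ ⟨a, b, -, hab, rfl⟩
    exact h a b hab

/-- Rewriting `x_{ab} x_{ba}` to `x_{aa} x_{bb}` along the edges terminates, because it lowers the
degree in the off-diagonal variables. -/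
lemma exists_isReduced_sub_mem (u : Fin n × Fin n →₀ ℕ) :
    ∃ v, IsReduced G v ∧ (monomial u 1 - monomial v 1 : MatrixPoly n K) ∈ diagIdeal K G := by
  let δ : (Fin n × Fin n →₀ ℕ) →+ ℕ :=
    Finsupp.weight (fun p : Fin n × Fin n => if p.1 = p.2 then 0 else 1)
  induction hk : δ u using Nat.strong_induction_on generalizing u with
  | _ k ih =>
    by_cases hred : IsReduced G u
    · exact ⟨u, hred, by simp⟩
    simp only [IsReduced, not_forall, not_or] at hred
    obtain ⟨a, b, hab, h1, h2⟩ := hred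
    have hne := hab.ne
    have hle : Finsupp.single (a, b) 1 + Finsupp.single (b, a) 1 ≤ u := by
      intro p
      simp only [Finsupp.add_apply, Finsupp.single_apply]
      grind
    obtain ⟨w, rfl⟩ := exists_add_of_le hle
    have hlt : δ (Finsupp.single (a, a) 1 + Finsupp.single (b, b) 1 + w) < k := by
      rw [← hk]
      simp [δ, Finsupp.weight_single, hne, hne.symm]
    obtain ⟨v, hv, hmem⟩ := ih _ hlt _ rfl
    refine ⟨v, hv, ?_⟩
    have e : (monomial (Finsupp.single (a, b) 1 + Finsupp.single (b, a) 1 + w) 1 -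
        monomial v 1 : MatrixPoly n K) =
        (monomial (Finsupp.single (a, a) 1 + Finsupp.single (b, b) 1 + w) 1 - monomial v 1) -
          monomial w 1 * diagMinor K a b := by
      have hX : ∀ p : Fin n × Fin n, (X p : MatrixPoly n K) = monomial (Finsupp.single p 1) 1 :=
        fun _ => rfl
      have hadd : ∀ s t : Fin n × Fin n →₀ ℕ,
          (monomial (s + t) 1 : MatrixPoly n K) = monomial s 1 * monomial t 1 := by
        intro s t
        rw [monomial_mul, one_mul]
      simp only [diagMinor, hX, hadd]
      ring
    rw [e]
    exact Ideal.sub_mem _ hmem (Ideal.mul_mem_left _ _ (diagMinor_mem_diagIdeal K hab))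

/-- The ring homomorphism from `S` to a Laurent polynomial ring that maps each monomial to the
Laurent monomial given by `toricExponent`. Its kernel is `P_G`. -/
noncomputable def toricHom : MatrixPoly n K →+* AddMonoidAlgebra K (Fin n × Fin n → ℤ) :=
  AddMonoidAlgebra.mapDomainRingHom K (toricExponent G)

lemma toricHom_monomial (u : Fin n × Fin n →₀ ℕ) (c : K) :
    toricHom K G (monomial u c) = AddMonoidAlgebra.single (toricExponent G u) c :=
  AddMonoidAlgebra.mapDomain_single

lemma diagIdeal_le_ker_toricHom : diagIdeal K G ≤ RingHom.ker (toricHom K G) := by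
  rw [diagIdeal_le_iff]
  intro a b hab
  have hX : ∀ p q : Fin n × Fin n, (X p * X q : MatrixPoly n K) =
      monomial (Finsupp.single p 1 + Finsupp.single q 1) 1 := by
    intro p q
    rw [X, X, monomial_mul, one_mul]
  rw [RingHom.mem_ker, diagMinor, hX, hX, map_sub, toricHom_monomial, toricHom_monomial,
    toricExponent_diag_of_adj G hab, sub_self]

/-- Replacing every monomial by its normal form changes a polynomial only modulo `P_G`, and the
result depends only on the image under `toricHom`; so it is zero on the kernel. -/
lemma ker_toricHom_le_diagIdeal : RingHom.ker (toricHom K G) ≤ diagIdeal K G := by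
  have hex : ∀ y : Fin n × Fin n → ℤ, ∃ v : Fin n × Fin n →₀ ℕ,
      (∃ u, IsReduced G u ∧ toricExponent G u = y) → IsReduced G v ∧ toricExponent G v = y := by
    intro y
    by_cases h : ∃ u, IsReduced G u ∧ toricExponent G u = y
    · exact ⟨h.choose, fun _ => h.choose_spec⟩
    · exact ⟨0, fun h' => absurd h' h⟩
  choose g hg using hex
  -- `g` sends the toric exponent of a monomial to the exponent of its normal form.
  have hnf : ∀ u : Fin n × Fin n →₀ ℕ,
      (monomial u 1 - monomial (g (toricExponent G u)) 1 : MatrixPoly n K) ∈ diagIdeal K G := by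
    intro u
    obtain ⟨v, hv, hmem⟩ := exists_isReduced_sub_mem K G u
    have hker := diagIdeal_le_ker_toricHom K G hmem
    rw [RingHom.mem_ker, map_sub, toricHom_monomial, toricHom_monomial, sub_eq_zero] at hker
    have huv : toricExponent G u = toricExponent G v :=
      AddMonoidAlgebra.single_left_injective one_ne_zero hker
    obtain ⟨hg1, hg2⟩ := hg _ ⟨v, hv, rfl⟩
    rw [huv, hg1.eq_of_toricExponent_eq hv hg2]
    exact hmem
  have key : ∀ f : MatrixPoly n K,
      f - AddMonoidAlgebra.mapDomain g (toricHom K G f) ∈ diagIdeal K G := by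
    intro f
    induction f using MvPolynomial.induction_on' with
    | monomial u c =>
      have e : (monomial u c - AddMonoidAlgebra.mapDomain g (toricHom K G (monomial u c)) :
          MatrixPoly n K) = C c * (monomial u 1 - monomial (g (toricExponent G u)) 1) := by
        rw [toricHom_monomial, AddMonoidAlgebra.mapDomain_single, mul_sub, C_mul_monomial,
          C_mul_monomial, mul_one]
        rfl
      rw [e]
      exact Ideal.mul_mem_left _ _ (hnf u)
    | add p q hp hq =>
      rw [map_add, AddMonoidAlgebra.mapDomain_add, add_sub_add_comm]
      exact Ideal.add_mem _ hp hq
  intro f hf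
  have := key f
  rwa [RingHom.mem_ker.1 hf, AddMonoidAlgebra.mapDomain_zero, sub_zero] at this

lemma isPrime_diagIdeal : (diagIdeal K G).IsPrime := by
  rw [le_antisymm (diagIdeal_le_ker_toricHom K G) (ker_toricHom_le_diagIdeal K G)]
  exact RingHom.ker_isPrime _

end Toric

/-! ### Ideals generated by `P_G` and variables -/

section VariableIdeals

variable {n : ℕ} (K : Type*) [Field K] (G : SimpleGraph (Fin n))

/-- The ideal generated by `P_G` and the variables indexed by `W`. -/
noncomputable def diagVarIdeal (W : Set (Fin n × Fin n)) : Ideal (MatrixPoly n K) :=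
  diagIdeal K G ⊔ Ideal.span (X '' W)

/-- No variable indexed by `W` occurs in a generator `f_{ab}` of `P_G`. -/
def AvoidsEdges (W : Set (Fin n × Fin n)) : Prop :=
  ∀ a b, G.Adj a b → (a, a) ∉ W ∧ (a, b) ∉ W

variable {G} in
lemma AvoidsEdges.mono {W W' : Set (Fin n × Fin n)} (h : AvoidsEdges G W) (hW : W' ⊆ W) :
    AvoidsEdges G W' :=
  fun a b hab => ⟨fun h' => (h a b hab).1 (hW h'), fun h' => (h a b hab).2 (hW h')⟩

lemma X_mem_diagVarIdeal_iff {W : Set (Fin n × Fin n)} {p : Fin n × Fin n} :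
    X p ∈ diagVarIdeal K G W ↔ p ∈ W := by
  constructor
  · -- Evaluate at the matrix unit with entry `1` in position `p`.
    intro h
    by_contra hp
    let ev : MatrixPoly n K →+* K := eval (Pi.single p 1)
    have hle : diagVarIdeal K G W ≤ RingHom.ker ev := by
      refine sup_le ((diagIdeal_le_iff G).2 ?_) (Ideal.span_le.2 ?_)
      · intro a b hab
        have hne := hab.ne
        rw [RingHom.mem_ker]
        simp only [ev, diagMinor, map_sub, map_mul, eval_X, Pi.single_apply]
        grind
      · rintro _ ⟨q, hq, rfl⟩
        have hqp : q ≠ p := fun e => hp (e ▸ hq)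
        simp [ev, RingHom.mem_ker, hqp]
    have := hle h
    simp [ev, RingHom.mem_ker] at this
  · exact fun h => Ideal.mem_sup_right (Ideal.subset_span ⟨p, h, rfl⟩)

variable {G} in
/-- Setting the variables in `W` to zero fixes the generators of `P_G`, so the ideal is the
preimage of the prime `P_G` under this endomorphism. -/
lemma isPrime_diagVarIdeal {W : Set (Fin n × Fin n)} (hW : AvoidsEdges G W) :
    (diagVarIdeal K G W).IsPrime := by
  classical
  let κ : MatrixPoly n K →ₐ[K] MatrixPoly n K := aeval fun p => if p ∈ W then 0 else X p
  have hκ : ∀ f, f - κ f ∈ Ideal.span (X '' W : Set (MatrixPoly n K)) := by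
    have h : (Ideal.Quotient.mkₐ K (Ideal.span (X '' W : Set (MatrixPoly n K)))).comp κ =
        Ideal.Quotient.mkₐ K _ := by
      refine algHom_ext fun p => ?_
      simp only [κ, AlgHom.comp_apply, aeval_X]
      split_ifs with hp
      · rw [map_zero, eq_comm, Ideal.Quotient.mkₐ_eq_mk, Ideal.Quotient.eq_zero_iff_mem]
        exact Ideal.subset_span ⟨p, hp, rfl⟩
      · rfl
    intro f
    exact Ideal.Quotient.eq.1 (DFunLike.congr_fun h f).symm
  have hle : diagVarIdeal K G W ≤ (diagIdeal K G).comap κ := by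
    refine sup_le ((diagIdeal_le_iff G).2 ?_) (Ideal.span_le.2 ?_)
    · intro a b hab
      have h1 := hW a b hab
      have h2 := hW b a hab.symm
      have e : κ (diagMinor K a b) = diagMinor K a b := by
        simp [κ, diagMinor, h1, h2]
      rw [Ideal.mem_comap, e]
      exact diagMinor_mem_diagIdeal K hab
    · rintro _ ⟨p, hp, rfl⟩
      simp [κ, hp]
  have hge : (diagIdeal K G).comap κ ≤ diagVarIdeal K G W := by
    intro f hf
    rw [← sub_add_cancel f (κ f)]
    exact Ideal.add_mem _ (Ideal.mem_sup_right (hκ f)) (Ideal.mem_sup_left hf)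
  have := isPrime_diagIdeal K G
  rw [le_antisymm hle hge]
  exact Ideal.comap_isPrime κ _

lemma diagVarIdeal_empty : diagVarIdeal K G ∅ = diagIdeal K G := by
  simp [diagVarIdeal]

lemma diagIdeal_mono {G H : SimpleGraph (Fin n)} (h : H ≤ G) : diagIdeal K H ≤ diagIdeal K G :=
  (diagIdeal_le_iff H).2 fun _ _ hab => diagMinor_mem_diagIdeal K (h hab)

lemma ncard_edgeSet_le_height_diagIdeal : (G.edgeSet.ncard : ℕ∞) ≤ (diagIdeal K G).height := by
  induction hk : G.edgeSet.ncard generalizing G with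
  | zero => simp
  | succ k ih =>
    obtain ⟨e, he⟩ := Set.nonempty_of_ncard_ne_zero (by omega : G.edgeSet.ncard ≠ 0)
    induction e with
    | _ a b =>
    have hab : G.Adj a b := he
    have hne := hab.ne
    have hcard : (G.deleteEdges {s(a, b)}).edgeSet.ncard = k := by
      rw [SimpleGraph.edgeSet_deleteEdges, Set.ncard_sdiff_singleton_of_mem he, hk]
      rfl
    have hlt : diagIdeal K (G.deleteEdges {s(a, b)}) < diagIdeal K G := by
      refine lt_of_le_of_ne (diagIdeal_mono K (G.deleteEdges_le _)) fun heq => ?_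
      -- At the matrix with `x_{ab} = x_{ba} = 1` and all other entries `0`, only `f_{ab}` survives.
      let ev : MatrixPoly n K →+* K := eval fun p => if p = (a, b) ∨ p = (b, a) then 1 else 0
      have hle : diagIdeal K (G.deleteEdges {s(a, b)}) ≤ RingHom.ker ev := by
        rw [diagIdeal_le_iff]
        intro c d hcd
        rw [SimpleGraph.deleteEdges_adj] at hcd
        have hcd' := hcd.1.ne
        have hs : s(c, d) ≠ s(a, b) := hcd.2
        rw [Ne, Sym2.eq_iff] at hs
        rw [RingHom.mem_ker]
        simp only [ev, diagMinor, map_sub, map_mul, eval_X]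
        grind
      have hmem : diagMinor K a b ∈ diagIdeal K (G.deleteEdges {s(a, b)}) :=
        heq ▸ diagMinor_mem_diagIdeal K hab
      have h0 := hle hmem
      simp [ev, diagMinor, RingHom.mem_ker, hne, hne.symm] at h0
    have := isPrime_diagIdeal K G
    have := isPrime_diagIdeal K (G.deleteEdges {s(a, b)})
    calc ((k + 1 : ℕ) : ℕ∞) = (k : ℕ∞) + 1 := by push_cast; rfl
      _ ≤ (diagIdeal K (G.deleteEdges {s(a, b)})).height + 1 := by
        gcongr
        exact ih _ hcard
      _ ≤ _ := Ideal.height_add_one_le_of_lt_of_isPrime hlt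

variable {G} in
/-- Adding the edges and then the variables one at a time gives a strictly increasing chain of
primes; conversely, Krull's height theorem applies to the evident generators. -/
lemma height_diagVarIdeal {W : Set (Fin n × Fin n)} (hW : AvoidsEdges G W) :
    (diagVarIdeal K G W).height = (G.edgeSet.ncard + W.ncard : ℕ) := by
  have hp := isPrime_diagVarIdeal K hW
  apply le_antisymm
  · let D : Sym2 (Fin n) → MatrixPoly n K := Sym2.lift ⟨diagMinor K, diagMinor_comm K⟩
    have hspan : diagVarIdeal K G W = Ideal.span (D '' G.edgeSet ∪ X '' W) := by
      rw [Ideal.span_union, diagVarIdeal]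
      congr 1
      apply le_antisymm
      · rw [diagIdeal_le_iff]
        exact fun a b hab => Ideal.subset_span ⟨s(a, b), hab, rfl⟩
      · rw [Ideal.span_le]
        rintro _ ⟨e, he, rfl⟩
        induction e with
        | _ a b => exact diagMinor_mem_diagIdeal K he
    have hmin : diagVarIdeal K G W ∈ (Ideal.span (D '' G.edgeSet ∪ X '' W)).minimalPrimes := by
      rw [← hspan, Ideal.minimalPrimes_eq_subsingleton_self]
      rfl
    refine (Ideal.height_le_card_of_mem_minimalPrimes_span (Set.toFinite _) hmin).trans ?_
    exact_mod_cast (Set.ncard_union_le _ _).trans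
      (add_le_add (Set.ncard_image_le (Set.toFinite _)) (Set.ncard_image_le (Set.toFinite _)))
  · clear hp
    induction W, Set.toFinite W using Set.Finite.induction_on with
    | empty => simpa [diagVarIdeal_empty] using ncard_edgeSet_le_height_diagIdeal K G
    | @insert p W hpW hfin ih =>
      have hW' : AvoidsEdges G W := hW.mono (Set.subset_insert _ _)
      have := isPrime_diagVarIdeal K hW
      have := isPrime_diagVarIdeal K hW'
      have hle : diagVarIdeal K G W ≤ diagVarIdeal K G (insert p W) :=
        sup_le_sup_left (Ideal.span_mono (Set.image_mono (Set.subset_insert _ _))) _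
      have hlt : diagVarIdeal K G W < diagVarIdeal K G (insert p W) := by
        refine lt_of_le_of_ne hle fun h => hpW ?_
        rw [← X_mem_diagVarIdeal_iff K G, h, X_mem_diagVarIdeal_iff]
        exact Set.mem_insert _ _
      rw [Set.ncard_insert_of_notMem hpW hfin, ← add_assoc]
      calc ((G.edgeSet.ncard + W.ncard + 1 : ℕ) : ℕ∞)
          = (G.edgeSet.ncard + W.ncard : ℕ) + 1 := by push_cast; rfl
        _ ≤ (diagVarIdeal K G W).height + 1 := by
          gcongr
          exact ih hW'
        _ ≤ _ := Ideal.height_add_one_le_of_lt_of_isPrime hlt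

lemma height_diagIdeal : (diagIdeal K G).height = G.edgeSet.ncard := by
  have h := height_diagVarIdeal K (G := G) (W := ∅) fun _ _ _ => ⟨id, id⟩
  rwa [diagVarIdeal_empty, Set.ncard_empty, add_zero] at h

/-- The ideal generated by `P_G`, the variables in `W` and the products `x_{av} x_{va}`, `a ∈ A`,
contains the intersection of the primes obtained by choosing one factor of each product. The proof
splits off one product at a time; the other factor stays a nonzerodivisor modulo the ideal in which
the first is adjoined, since by induction that ideal is an intersection of primes avoiding it. -/
lemma mem_of_forall_choice_mem {v : Fin n} (A : Finset (Fin n)) :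
    ∀ {W : Set (Fin n × Fin n)}, AvoidsEdges G {p | p ∈ W ∨ p.1 = v ∨ p.2 = v} → v ∉ A →
    (∀ a ∈ A, (a, v) ∉ W ∧ (v, a) ∉ W) → ∀ {f : MatrixPoly n K},
    (∀ c : Fin n → Fin n × Fin n, (∀ a ∈ A, c a = (a, v) ∨ c a = (v, a)) →
      f ∈ diagVarIdeal K G (W ∪ c '' A)) →
    f ∈ diagVarIdeal K G W ⊔ Ideal.span ((fun a => X (a, v) * X (v, a)) '' (A : Set (Fin n))) := by
  classical
  induction A using Finset.induction_on with
  | empty =>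
    intro W hW hvA hAW f hf
    simpa using hf (fun a => (a, v)) (by simp)
  | insert a A haA ih =>
    intro W hW hvA hAW f hf
    obtain ⟨hva, hvA⟩ : v ≠ a ∧ v ∉ A := by simpa using hvA
    set I := diagVarIdeal K G W ⊔
      Ideal.span ((fun a => X (a, v) * X (v, a)) '' ((insert a A : Finset (Fin n)) : Set (Fin n)))
    -- After adjoining one factor of the product belonging to `a`, the induction hypothesis applies.
    have hadd : ∀ p : Fin n × Fin n, p = (a, v) ∨ p = (v, a) →
        ∀ g : MatrixPoly n K, (g ∈ I ⊔ Ideal.span {X p} ↔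
          ∀ c : Fin n → Fin n × Fin n, (∀ b ∈ A, c b = (b, v) ∨ c b = (v, b)) →
            g ∈ diagVarIdeal K G (insert p W ∪ c '' A)) := by
      intro p hp g
      constructor
      · intro hg c hc
        refine (?_ : I ⊔ Ideal.span {X p} ≤ _) hg
        have hX : ∀ {q}, q ∈ insert p W ∪ c '' (A : Set (Fin n)) →
            (X q : MatrixPoly n K) ∈ diagVarIdeal K G (insert p W ∪ c '' A) :=
          fun h => (X_mem_diagVarIdeal_iff K G).2 h
        refine sup_le (sup_le (sup_le_sup_left (Ideal.span_mono (Set.image_mono ?_)) _)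
          (Ideal.span_le.2 ?_)) (Ideal.span_le.2 ?_)
        · exact (Set.subset_insert _ _).trans Set.subset_union_left
        · rintro _ ⟨b, hb, rfl⟩
          have : (b, v) ∈ insert p W ∪ c '' (A : Set (Fin n)) ∨
              (v, b) ∈ insert p W ∪ c '' (A : Set (Fin n)) := by
            rcases Finset.mem_insert.1 (Finset.mem_coe.1 hb) with rfl | hb
            · rcases hp with rfl | rfl
              · exact Or.inl (Or.inl (Set.mem_insert _ _))
              · exact Or.inr (Or.inl (Set.mem_insert _ _))
            · exact (hc b hb).imp (fun h => Or.inr ⟨b, hb, h⟩) (fun h => Or.inr ⟨b, hb, h⟩)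
          rcases this with h | h
          · exact Ideal.mul_mem_right _ _ (hX h)
          · exact Ideal.mul_mem_left _ _ (hX h)
        · rintro _ rfl
          exact hX (Or.inl (Set.mem_insert _ _))
      · intro hg
        have h := ih (W := insert p W) (hW.mono ?_) hvA ?_ hg
        · refine (?_ : diagVarIdeal K G (insert p W) ⊔ Ideal.span _ ≤ _) h
          rw [diagVarIdeal, Set.image_insert_eq, Ideal.span_insert]
          refine sup_le (sup_le ?_ (sup_le ?_ ?_)) ?_
          · exact (le_sup_left.trans le_sup_left).trans le_sup_left
          · exact le_sup_right
          · exact (le_sup_right.trans le_sup_left).trans le_sup_left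
          · refine le_trans (Ideal.span_mono (Set.image_mono ?_))
              (le_sup_right.trans le_sup_left)
            exact_mod_cast Finset.subset_insert a A
        · rintro q (hq | hq)
          · rcases hq with rfl | hq
            · rcases hp with rfl | rfl
              · exact Or.inr (Or.inr rfl)
              · exact Or.inr (Or.inl rfl)
            · exact Or.inl hq
          · exact Or.inr hq
        · intro b hb
          have := hAW b (Finset.mem_insert_of_mem hb)
          have hba : b ≠ a := fun h => haA (h ▸ hb)
          have hvb : v ≠ b := fun h => hvA (h ▸ hb)
          simp only [Set.mem_insert_iff, not_or]
          grind
    have hf' : ∀ p : Fin n × Fin n, p = (a, v) ∨ p = (v, a) → f ∈ I ⊔ Ideal.span {X p} := by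
      intro p hp
      rw [hadd p hp]
      intro c hc
      have h := hf (Function.update c a p) ?_
      · rw [Finset.coe_insert, Set.image_insert_eq, Function.update_self] at h
        have e : Function.update c a p '' (A : Set (Fin n)) = c '' A :=
          Set.image_congr fun b hb =>
            Function.update_of_ne (fun h : b = a => haA (h ▸ Finset.mem_coe.1 hb)) _ _
        rwa [e, Set.union_insert, ← Set.insert_union] at h
      · intro b hb
        rcases Finset.mem_insert.1 hb with rfl | hb
        · simpa using hp
        · rw [Function.update_of_ne (fun h : b = a => haA (h ▸ hb))]
          exact hc b hb
    refine mem_of_mem_sup_span_singleton (f := X (a, v)) (g := X (v, a)) ?_ ?_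
      (hf' _ (Or.inl rfl)) (hf' _ (Or.inr rfl))
    · refine Ideal.mem_sup_right (Ideal.subset_span ⟨a, ?_, rfl⟩)
      exact_mod_cast Finset.mem_insert_self a A
    · intro b hb
      rw [hadd _ (Or.inl rfl)] at hb ⊢
      intro c hc
      have hprime : (diagVarIdeal K G (insert (a, v) W ∪ c '' (A : Set (Fin n)))).IsPrime := by
        refine isPrime_diagVarIdeal K (hW.mono ?_)
        rintro q ((rfl | hq) | ⟨b, hb, rfl⟩)
        · exact Or.inr (Or.inr rfl)
        · exact Or.inl hq
        · rcases hc b hb with h | h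
          · exact Or.inr (Or.inr (by rw [h]))
          · exact Or.inr (Or.inl (by rw [h]))
      refine (hprime.mem_or_mem (hb c hc)).resolve_left fun hmem => ?_
      rw [X_mem_diagVarIdeal_iff] at hmem
      rcases hmem with (h | h) | ⟨b, hb, h⟩
      · exact hva (congrArg Prod.fst h)
      · exact (hAW a (Finset.mem_insert_self _ _)).2 h
      · have hba : b ≠ a := fun h => haA (h ▸ hb)
        have := hc b hb
        grind

end VariableIdeals

/-! ### Decomposition of `(P_G, x_{ji})` -/

section Decomposition

variable {n : ℕ} (K : Type*) [Field K] (G : SimpleGraph (Fin n))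

variable {G} in
lemma isTransversal_iff {v w : Fin n} {T : Set (MatrixPoly n K)} :
    IsTransversal K G v w T ↔ ∃ c : Fin n → Fin n × Fin n,
      (∀ a ∈ G.neighborSet v \ {w}, c a = (a, v) ∨ c a = (v, a)) ∧
        T = X '' (c '' (G.neighborSet v \ {w})) := by
  classical
  have hinj : Function.Injective (X : Fin n × Fin n → MatrixPoly n K) := X_injective
  constructor
  · rintro ⟨hT, hcard⟩
    have hex : ∀ a, ∃ p : Fin n × Fin n, a ∈ G.neighborSet v \ {w} →
        (p = (a, v) ∨ p = (v, a)) ∧ T ∩ varPair K v a = {X p} := by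
      intro a
      by_cases ha : a ∈ G.neighborSet v \ {w}
      · obtain ⟨x, hx⟩ := Set.ncard_eq_one.1 (hcard a ha)
        have hx' : x ∈ T ∩ varPair K v a := hx ▸ rfl
        rcases hx'.2 with h | h
        · exact ⟨(a, v), fun _ => ⟨Or.inl rfl, h ▸ hx⟩⟩
        · exact ⟨(v, a), fun _ => ⟨Or.inr rfl, (Set.mem_singleton_iff.1 h) ▸ hx⟩⟩
      · exact ⟨(a, v), fun h => absurd h ha⟩
    choose c hc using hex
    refine ⟨c, fun a ha => (hc a ha).1, Set.Subset.antisymm ?_ ?_⟩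
    · intro t ht
      obtain ⟨a, ha, hta⟩ := Set.mem_iUnion₂.1 (hT ht)
      have : t ∈ T ∩ varPair K v a := ⟨ht, hta⟩
      rw [(hc a ha).2, Set.mem_singleton_iff] at this
      exact ⟨c a, ⟨a, ha, rfl⟩, this.symm⟩
    · rintro _ ⟨_, ⟨a, ha, rfl⟩, rfl⟩
      have : X (c a) ∈ T ∩ varPair K v a := by
        rw [(hc a ha).2]
        rfl
      exact this.1
  · rintro ⟨c, hc, rfl⟩
    have hpair : ∀ a ∈ G.neighborSet v \ {w}, (X (c a) : MatrixPoly n K) ∈ varPair K v a := by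
      intro a ha
      rcases hc a ha with h | h <;> simp [varPair, h]
    refine ⟨?_, fun a ha => Set.ncard_eq_one.2 ⟨X (c a), Set.Subset.antisymm ?_ ?_⟩⟩
    · rintro _ ⟨_, ⟨a, ha, rfl⟩, rfl⟩
      exact Set.mem_iUnion₂.2 ⟨a, ha, hpair a ha⟩
    · rintro _ ⟨⟨_, ⟨b, hb, rfl⟩, rfl⟩, hmem⟩
      have hv : v ≠ a := ha.1.ne
      have hba : b = a := by
        simp only [varPair, Set.mem_insert_iff, Set.mem_singleton_iff, hinj.eq_iff] at hmem
        have := hc b hb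
        grind
      rw [hba]
      rfl
    · rintro _ rfl
      exact ⟨⟨_, ⟨a, ha, rfl⟩, rfl⟩, hpair a ha⟩

variable {G} in
lemma mem_primeClass_iff {v w : Fin n} {y : Fin n × Fin n} {Q : Ideal (MatrixPoly n K)} :
    Q ∈ primeClass K G v w (X y) ↔ ∃ c : Fin n → Fin n × Fin n,
      (∀ a ∈ G.neighborSet v \ {w}, c a = (a, v) ∨ c a = (v, a)) ∧
        Q = diagVarIdeal K (G.deleteIncidenceSet v)
          ({(v, v), y} ∪ c '' (G.neighborSet v \ {w})) := by
  have e : ∀ c : Fin n → Fin n × Fin n,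
      diagVarIdeal K (G.deleteIncidenceSet v) ({(v, v), y} ∪ c '' (G.neighborSet v \ {w})) =
        diagIdeal K (G.deleteIncidenceSet v) ⊔
          Ideal.span ({X (v, v), X y} ∪ X '' (c '' (G.neighborSet v \ {w}))) := by
    intro c
    rw [diagVarIdeal, Set.image_union, Set.image_pair]
  constructor
  · rintro ⟨T, hT, rfl⟩
    obtain ⟨c, hc, rfl⟩ := (isTransversal_iff K).1 hT
    exact ⟨c, hc, (e c).symm⟩
  · rintro ⟨c, hc, rfl⟩
    exact ⟨_, (isTransversal_iff K).2 ⟨c, hc, rfl⟩, e c⟩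

lemma avoidsEdges_deleteIncidenceSet {v : Fin n} {W : Set (Fin n × Fin n)}
    (hW : ∀ p ∈ W, p.1 = v ∨ p.2 = v) : AvoidsEdges (G.deleteIncidenceSet v) W := by
  intro a b hab
  rw [SimpleGraph.deleteIncidenceSet_adj] at hab
  exact ⟨fun h => (hW _ h).elim hab.2.1 hab.2.1, fun h => (hW _ h).elim hab.2.1 hab.2.2⟩

lemma ncard_edgeSet_deleteIncidenceSet_add (v : Fin n) :
    (G.deleteIncidenceSet v).edgeSet.ncard + (G.neighborSet v).ncard = G.edgeSet.ncard := by
  classical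
  have h : (G.incidenceSet v).ncard = (G.neighborSet v).ncard :=
    Nat.card_congr (G.incidenceSetEquivNeighborSet v)
  rw [SimpleGraph.edgeSet_deleteIncidenceSet, ← h]
  exact Set.ncard_sdiff_add_ncard_of_subset (G.incidenceSet_subset v) (Set.toFinite _)

variable {G} in
lemma ncard_primeClass_vars {v w : Fin n} {y : Fin n × Fin n} (hadj : G.Adj v w)
    (hy : y = (v, w) ∨ y = (w, v)) {c : Fin n → Fin n × Fin n}
    (hc : ∀ a ∈ G.neighborSet v \ {w}, c a = (a, v) ∨ c a = (v, a)) :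
    ({(v, v), y} ∪ c '' (G.neighborSet v \ {w})).ncard = (G.neighborSet v).ncard + 1 := by
  have hne := hadj.ne
  have hyv : (v, v) ≠ y := by grind
  have hinj : Set.InjOn c (G.neighborSet v \ {w}) := by
    intro a ha b hb h
    have h1 := hc a ha
    have h2 := hc b hb
    grind
  have hdisj : Disjoint {(v, v), y} (c '' (G.neighborSet v \ {w})) := by
    rw [Set.disjoint_right]
    rintro _ ⟨a, ha, rfl⟩
    have h1 := hc a ha
    have h2 : v ≠ a := ha.1.ne
    have h3 : a ≠ w := ha.2
    simp only [Set.mem_insert_iff, Set.mem_singleton_iff]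
    grind
  rw [Set.ncard_union_eq hdisj, Set.ncard_pair hyv, hinj.ncard_image]
  have := Set.ncard_sdiff_singleton_add_one (s := G.neighborSet v) (a := w) hadj
  omega

variable {G} in
lemma incident_of_mem_primeClass_vars {v w : Fin n} {y : Fin n × Fin n}
    (hy : y = (v, w) ∨ y = (w, v)) {c : Fin n → Fin n × Fin n}
    (hc : ∀ a ∈ G.neighborSet v \ {w}, c a = (a, v) ∨ c a = (v, a)) :
    ∀ p ∈ {(v, v), y} ∪ c '' (G.neighborSet v \ {w}), p.1 = v ∨ p.2 = v := by
  rintro p ((rfl | rfl) | ⟨a, ha, rfl⟩)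
  · exact Or.inl rfl
  · grind
  · have := hc a ha
    grind

section PrimeClass

variable {v w : Fin n} {y : Fin n × Fin n}

variable {G K} in
lemma isPrime_of_mem_primeClass (hy : y = (v, w) ∨ y = (w, v)) {Q : Ideal (MatrixPoly n K)}
    (hQ : Q ∈ primeClass K G v w (X y)) : Q.IsPrime := by
  obtain ⟨c, hc, rfl⟩ := (mem_primeClass_iff K).1 hQ
  exact isPrime_diagVarIdeal K
    (avoidsEdges_deleteIncidenceSet G (incident_of_mem_primeClass_vars hy hc))

variable {G K} in
lemma height_of_mem_primeClass (hadj : G.Adj v w) (hy : y = (v, w) ∨ y = (w, v))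
    {Q : Ideal (MatrixPoly n K)} (hQ : Q ∈ primeClass K G v w (X y)) :
    Q.height = (diagIdeal K G).height + 1 := by
  obtain ⟨c, hc, rfl⟩ := (mem_primeClass_iff K).1 hQ
  rw [height_diagVarIdeal K
    (avoidsEdges_deleteIncidenceSet G (incident_of_mem_primeClass_vars hy hc)),
    ncard_primeClass_vars hadj hy hc, height_diagIdeal, ← add_assoc,
    ncard_edgeSet_deleteIncidenceSet_add]
  push_cast
  rfl

variable {G K} in
lemma X_diag_notMem_of_mem_primeClass (hy : y = (v, w) ∨ y = (w, v)) {x : Fin n} (hx : x ≠ v)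
    {Q : Ideal (MatrixPoly n K)} (hQ : Q ∈ primeClass K G v w (X y)) : X (x, x) ∉ Q := by
  obtain ⟨c, hc, rfl⟩ := (mem_primeClass_iff K).1 hQ
  rw [X_mem_diagVarIdeal_iff]
  exact fun h => (incident_of_mem_primeClass_vars hy hc _ h).elim hx hx

lemma primeClass_nonempty : (primeClass K G v w (X y)).Nonempty :=
  ⟨_, (mem_primeClass_iff K).2 ⟨fun a => (a, v), fun _ _ => Or.inl rfl, rfl⟩⟩

lemma primeClass_finite : (primeClass K G v w (X y)).Finite := by
  refine (Set.finite_range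
    (diagVarIdeal K (G.deleteIncidenceSet v) : Set (Fin n × Fin n) → _)).subset ?_
  intro Q hQ
  obtain ⟨c, -, rfl⟩ := (mem_primeClass_iff K).1 hQ
  exact ⟨_, rfl⟩

variable {G} in
/-- Modulo `x_{vv}`, the minor `f_{av}` becomes `- x_{av} x_{va}`, so `(P_G, x_{vv}, y)` is
generated by `P_{G \ v}`, the variables `x_{vv}`, `y` and these products. -/
lemma sup_span_X_diag_eq_sInf_primeClass (hadj : G.Adj v w) (hy : y = (v, w) ∨ y = (w, v)) :
    diagIdeal K G ⊔ Ideal.span {X y} ⊔ Ideal.span {X (v, v)} = sInf (primeClass K G v w (X y)) := by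
  classical
  have hvw := hadj.ne
  apply le_antisymm
  · refine le_sInf fun Q hQ => ?_
    obtain ⟨c, hc, rfl⟩ := (mem_primeClass_iff K).1 hQ
    have hX : ∀ {q}, q ∈ {(v, v), y} ∪ c '' (G.neighborSet v \ {w}) →
        (X q : MatrixPoly n K) ∈ diagVarIdeal K (G.deleteIncidenceSet v)
          ({(v, v), y} ∪ c '' (G.neighborSet v \ {w})) :=
      fun h => (X_mem_diagVarIdeal_iff K _).2 h
    have hvb : ∀ b, G.Adj v b → diagMinor K v b ∈ diagVarIdeal K (G.deleteIncidenceSet v)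
        ({(v, v), y} ∪ c '' (G.neighborSet v \ {w})) := by
      intro b hb
      refine Ideal.sub_mem _ (Ideal.mul_mem_right _ _ (hX (Or.inl (Or.inl rfl)))) ?_
      have : (v, b) ∈ {(v, v), y} ∪ c '' (G.neighborSet v \ {w}) ∨
          (b, v) ∈ {(v, v), y} ∪ c '' (G.neighborSet v \ {w}) := by
        by_cases hbw : b = w
        · subst hbw
          exact hy.imp (fun h => Or.inl (Or.inr h.symm)) (fun h => Or.inl (Or.inr h.symm))
        · have hb' : b ∈ G.neighborSet v \ {w} := ⟨hb, hbw⟩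
          rcases hc b hb' with h | h
          · exact Or.inr (Or.inr ⟨b, hb', h⟩)
          · exact Or.inl (Or.inr ⟨b, hb', h⟩)
      rcases this with h | h
      · exact Ideal.mul_mem_right _ _ (hX h)
      · exact Ideal.mul_mem_left _ _ (hX h)
    refine sup_le (sup_le ((diagIdeal_le_iff G).2 ?_) (Ideal.span_le.2 ?_)) (Ideal.span_le.2 ?_)
    · intro a b hab
      by_cases hav : a = v
      · exact hav ▸ hvb b (hav ▸ hab)
      by_cases hbv : b = v
      · rw [diagMinor_comm]
        exact hbv ▸ hvb a (hbv ▸ hab.symm)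
      · exact Ideal.mem_sup_left (diagMinor_mem_diagIdeal K
          (SimpleGraph.deleteIncidenceSet_adj.2 ⟨hab, hav, hbv⟩))
    · rintro _ rfl
      exact hX (Or.inl (Or.inr rfl))
    · rintro _ rfl
      exact hX (Or.inl (Or.inl rfl))
  · intro f hf
    rw [Submodule.mem_sInf] at hf
    have hA : ((G.neighborSet v \ {w}).toFinset : Set (Fin n)) = G.neighborSet v \ {w} :=
      Set.coe_toFinset _
    have h := mem_of_forall_choice_mem K (G.deleteIncidenceSet v) (v := v)
      (G.neighborSet v \ {w}).toFinset (W := {(v, v), y}) ?_ ?_ ?_ (f := f) ?_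
    · refine (?_ : diagVarIdeal K (G.deleteIncidenceSet v) {(v, v), y} ⊔ Ideal.span _ ≤ _) h
      rw [diagVarIdeal, Set.image_pair, hA]
      refine sup_le (sup_le ?_ ?_) ?_
      · exact ((diagIdeal_mono K (G.deleteIncidenceSet_le v)).trans le_sup_left).trans le_sup_left
      · rw [Ideal.span_insert]
        exact sup_le le_sup_right (le_sup_right.trans le_sup_left)
      · rw [Ideal.span_le]
        rintro _ ⟨a, ha, rfl⟩
        have e : (X (a, v) * X (v, a) : MatrixPoly n K) =
            X (a, a) * X (v, v) - diagMinor K v a := by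
          rw [diagMinor]
          ring
        change X (a, v) * X (v, a) ∈ _
        rw [e]
        refine Ideal.sub_mem _ (Ideal.mul_mem_left _ _ (Ideal.mem_sup_right
          (Ideal.mem_span_singleton_self _))) ?_
        exact Ideal.mem_sup_left (Ideal.mem_sup_left (diagMinor_mem_diagIdeal K ha.1))
    · refine avoidsEdges_deleteIncidenceSet G ?_
      rintro p ((rfl | rfl) | h)
      · exact Or.inl rfl
      · grind
      · exact h
    · simp
    · intro a ha
      rw [Set.mem_toFinset] at ha
      have h1 : v ≠ a := ha.1.ne
      have h2 : a ≠ w := ha.2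
      simp only [Set.mem_insert_iff, Set.mem_singleton_iff]
      grind
    · intro c hc
      rw [hA]
      exact hf _ ((mem_primeClass_iff K).2 ⟨c, fun a ha => hc a (Set.mem_toFinset.2 ha), rfl⟩)

end PrimeClass

variable {G} in
/-- Since `x_{ii} x_{jj} = f_{ij} + x_{ij} x_{ji}`, the ideal `(P_G, x_{ji})` splits as
`(P_G, x_{ji}, x_{ii}) ∩ (P_G, x_{ji}, x_{jj})`. -/
lemma sup_span_X_eq_sInf {i j : Fin n} (hadj : G.Adj i j) :
    diagIdeal K G ⊔ Ideal.span {X (j, i)} =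
      sInf (primeClass K G i j (X (j, i)) ∪ primeClass K G j i (X (j, i))) := by
  have hi := sup_span_X_diag_eq_sInf_primeClass K hadj (y := (j, i)) (Or.inr rfl)
  have hj := sup_span_X_diag_eq_sInf_primeClass K hadj.symm (y := (j, i)) (Or.inl rfl)
  rw [sInf_union, ← hi, ← hj]
  refine le_antisymm (le_inf le_sup_left le_sup_left) ?_
  rintro f ⟨hfi, hfj⟩
  refine mem_of_mem_sup_span_singleton ?_ ?_ hfi hfj
  · have e : (X (i, i) * X (j, j) : MatrixPoly n K) =
        diagMinor K i j + X (i, j) * X (j, i) := by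
      rw [diagMinor]
      ring
    rw [e]
    exact Ideal.add_mem _ (Ideal.mem_sup_left (diagMinor_mem_diagIdeal K hadj))
      (Ideal.mem_sup_right (Ideal.mul_mem_left _ _ (Ideal.mem_span_singleton_self _)))
  · intro b hb
    rw [hi, Submodule.mem_sInf] at hb ⊢
    intro Q hQ
    exact ((isPrime_of_mem_primeClass (Or.inr rfl) hQ).mem_or_mem (hb Q hQ)).resolve_left
      (X_diag_notMem_of_mem_primeClass (Or.inr rfl) hadj.ne' hQ)

end Decomposition

end DiagonalMinors

theorem lemma2p1 {n : ℕ} (K : Type*) [Field K] (G : SimpleGraph (Fin n)) (i j : Fin n)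
    (hij : i < j) (hadj : G.Adj i j) :
    (DiagonalMinors.IsUnmixed
        (DiagonalMinors.diagIdeal K G ⊔ Ideal.span {MvPolynomial.X (j, i)}) ∧
      (DiagonalMinors.diagIdeal K G ⊔ Ideal.span {MvPolynomial.X (j, i)}).IsRadical ∧
      (DiagonalMinors.diagIdeal K G ⊔ Ideal.span {MvPolynomial.X (j, i)}).height =
        (DiagonalMinors.diagIdeal K G).height + 1) ∧
    (DiagonalMinors.diagIdeal K G ⊔ Ideal.span {MvPolynomial.X (j, i)}).minimalPrimes =
      DiagonalMinors.primeClass K G i j (MvPolynomial.X (j, i)) ∪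
        DiagonalMinors.primeClass K G j i (MvPolynomial.X (j, i)) := by
  open DiagonalMinors in
  rw [sup_span_X_eq_sInf K hadj]
  set F := primeClass K G i j (MvPolynomial.X (j, i)) ∪ primeClass K G j i (MvPolynomial.X (j, i))
  have hfin : F.Finite := (primeClass_finite K G).union (primeClass_finite K G)
  have hne : F.Nonempty := (primeClass_nonempty K G).inl
  have hprime : ∀ Q ∈ F, Q.IsPrime := fun Q hQ => hQ.elim
    (isPrime_of_mem_primeClass (Or.inr rfl)) (isPrime_of_mem_primeClass (Or.inl rfl))
  have hheight : ∀ Q ∈ F, Q.height = (diagIdeal K G).height + 1 := fun Q hQ => hQ.elim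
    (height_of_mem_primeClass hadj (Or.inr rfl)) (height_of_mem_primeClass hadj.symm (Or.inl rfl))
  have hF := height_sInf_of_height_eq hfin hne hprime hheight
  refine ⟨⟨fun P hP => ?_, isRadical_sInf_of_isPrime hprime, hF⟩,
    minimalPrimes_sInf_of_height_eq hfin hprime hheight⟩
  rw [hF, hheight P (associatedPrimes_quotient_sInf_subset hfin hprime hP)]
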